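/- Let $A$ be a finite set with $k$ elements and let $\circ$ be a binary operation on $A$ such that $(A;\circ)$ is a semilattice (that is, $\circ$ is associative, commutative and idempotent) or a Boolean group (a group in which $x\circ x$ is the neutral element for every $x$). Let $\mathrm{Clo}(\circ)$ be the clone of term operations of $(A;\circ)$, i.e. the least set of finitary operations on $A$ of positive arity that contains $\circ$ and all projections and is closed under composition, and let $\mathcal{C}\subseteq\mathrm{Clo}(\circ)$ be a clone on $A$ (a set of such operations that contains all projections and is closed under composition). Then every operation $f\in\mathcal{C}$ of arity $n\ge k+2$ is set-reconstructible; that is, the class $\mathcal{C}^{(\ge k+2)}$ of members of $\mathcal{C}$ of arity at least $k+2$ is set-reconstructible. Here the notions are the following. A function $f\colon A^n\to A$ is a minor of $g\colon A^m\to A$ if there is a map $\sigma\colon\{1,\dots,m\}\to\{1,\dots,n\}$ with $f(a_1,\dots,a_n)=g(a_{\sigma(1)},\dots,a_{\sigma(m)})$ for all $a\in A^n$; $f$ and $g$ are equivalent, $f\equiv g$, if each is a minor of the other. For $f\colon A^n\to A$ and $I=\{i,j\}$ with $1\le i<j\le n$, the identification minor $f_I\colon A^{n-1}\to A$ is $f_I(a_1,\dots,a_{n-1})=f(a_1,\dots,a_{j-1},a_i,a_j,\dots,a_{n-1})$.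 The set-deck of $f$ is the set of the $\equiv$-classes of all $f_I$. An operation $f\colon A^n\to A$ is set-reconstructible if every $f'\colon A^n\to A$ with the same set-deck as $f$ is equivalent to $f$. -/

import Mathlib

namespace ArgRec

/-- The `n`-ary functions from `A` to `B`, i.e. the maps `A ^ n → B`. -/
abbrev Fn (A B : Type*) (n : ℕ) := (Fin n → A) → B

/-- All functions of several arguments from `A` to `B`, of any positive arity. -/
abbrev AnyFn (A B : Type*) := Σ n : ℕ+, Fn A B n

/-- `f ≤ g`: `f` is a minor of `g`. -/
def IsMinor {A B : Type*} {n m : ℕ} (f : Fn A B n) (g : Fn A B m) : Prop :=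
  ∃ σ : Fin m → Fin n, ∀ a : Fin n → A, f a = g (a ∘ σ)

/-- `f ≡ g`: each of `f` and `g` is a minor of the other. -/
def Equivalent {A B : Type*} {n m : ℕ} (f : Fn A B n) (g : Fn A B m) : Prop :=
  IsMinor f g ∧ IsMinor g f

theorem IsMinor.refl {A B : Type*} {n : ℕ} (f : Fn A B n) : IsMinor f f :=
  ⟨id, fun _ => rfl⟩

theorem IsMinor.trans {A B : Type*} {n m l : ℕ} {f : Fn A B n} {g : Fn A B m} {h : Fn A B l}
    (hfg : IsMinor f g) (hgh : IsMinor g h) : IsMinor f h := by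
  obtain ⟨σ, hσ⟩ := hfg
  obtain ⟨τ, hτ⟩ := hgh
  exact ⟨σ ∘ τ, fun a => by rw [hσ, hτ]; rfl⟩

/-- The equivalence relation `≡` on the set of all functions from `A` to `B`. -/
def equivSetoid (A B : Type*) : Setoid (AnyFn A B) where
  r f g := Equivalent f.2 g.2
  iseqv :=
    { refl := fun f => ⟨IsMinor.refl _, IsMinor.refl _⟩
      symm := fun h => ⟨h.2, h.1⟩
      trans := fun h₁ h₂ => ⟨h₁.1.trans h₂.1, h₂.2.trans h₁.2⟩ }

/-- The map `δ_I : {1, …, n} → {1, …, n - 1}` for the two-element set `I = {i, j}`, `i < j`,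
written with indices that start at `0`: it fixes everything below `j`, sends `j` to `i` and
shifts everything above `j` down by one. -/
def delta {n : ℕ} (i j : Fin n) (hij : i < j) (l : Fin n) : Fin (n - 1) :=
  if _h₁ : l < j then ⟨l, by omega⟩
  else if _h₂ : l = j then ⟨i, by omega⟩
  else ⟨l - 1, by omega⟩

/-- The identification minor `f_I` of `f` for `I = {i, j}`, `i < j`. -/
def identMinor {A B : Type*} {n : ℕ} (f : Fn A B n) (i j : Fin n) (hij : i < j) :
    Fn A B (n - 1) :=
  fun a => f (a ∘ delta i j hij)

/-- The card of `f` for `I = {i, j}`, `i < j`: the `≡`-class of the identification minor `f_I`. -/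
def card {A B : Type*} {n : ℕ} (f : Fn A B n) (i j : Fin n) (hij : i < j) :
    Quotient (equivSetoid A B) :=
  Quotient.mk (equivSetoid A B) ⟨⟨n - 1, by omega⟩, identMinor f i j hij⟩

/-- The set-deck of `f`: the set of its cards. -/
def setDeck {A B : Type*} {n : ℕ} (f : Fn A B n) : Set (Quotient (equivSetoid A B)) :=
  {c | ∃ (i j : Fin n) (hij : i < j), c = card f i j hij}

/-- `f'` is a set-reconstruction of `f`; both have the same arity. -/
def IsSetReconstruction {A B : Type*} {n : ℕ} (f' f : Fn A B n) : Prop :=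
  setDeck f = setDeck f'

/-- `f` is set-reconstructible: it is equivalent to all of its set-reconstructions. -/
def SetReconstructible {A B : Type*} {n : ℕ} (f : Fn A B n) : Prop :=
  ∀ f' : Fn A B n, IsSetReconstruction f' f → Equivalent f f'

/-- A class of functions is set-reconstructible if all of its members are. -/
def ClassSetReconstructible {A B : Type*} (C : Set (AnyFn A B)) : Prop :=
  ∀ f ∈ C, SetReconstructible f.2

/-- `C^{(≥ m)}`: the members of `C` of arity at least `m`. -/
def arityAtLeast {A B : Type*} (C : Set (AnyFn A B)) (m : ℕ) : Set (AnyFn A B) :=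
  {f ∈ C | m ≤ (f.1 : ℕ)}

/-- A clone on `A`: a class of operations on `A` that contains all projections and is closed under
composition. -/
structure IsClone {A : Type*} (C : Set (AnyFn A A)) : Prop where
  proj_mem : ∀ (n : ℕ+) (i : Fin n), (⟨n, fun a => a i⟩ : AnyFn A A) ∈ C
  comp_mem : ∀ (n m : ℕ+) (f : Fn A A n) (g : Fin n → Fn A A m),
    (⟨n, f⟩ : AnyFn A A) ∈ C → (∀ i, (⟨m, g i⟩ : AnyFn A A) ∈ C) →
    (⟨m, fun a => f (fun i => g i a)⟩ : AnyFn A A) ∈ C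

/-- A binary operation as a member of the set of all operations on `A`. -/
def binary {A : Type*} (op : A → A → A) : AnyFn A A :=
  ⟨2, fun a : Fin 2 → A => op (a 0) (a 1)⟩

/-- `Clo(∘)`: the clone of term operations of `(A; ∘)`, i.e. the least clone on `A` that
contains `∘`. -/
def Clo {A : Type*} (op : A → A → A) : Set (AnyFn A A) :=
  {f | ∀ C : Set (AnyFn A A), IsClone C → binary op ∈ C → f ∈ C}

theorem isClone_Clo {A : Type*} (op : A → A → A) : IsClone (Clo op) where
  proj_mem n i _ hC _ := hC.proj_mem n i
  comp_mem n m f g hf hg C hC hop :=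
    hC.comp_mem n m f g (hf C hC hop) (fun i => hg i C hC hop)

theorem binary_mem_Clo {A : Type*} (op : A → A → A) : binary op ∈ Clo op :=
  fun _ _ hop => hop

/-- `(A; ∘)` is a semilattice: an associative, commutative and idempotent groupoid. -/
structure IsSemilattice {A : Type*} (op : A → A → A) : Prop where
  assoc : ∀ x y z, op (op x y) z = op x (op y z)
  comm : ∀ x y, op x y = op y x
  idem : ∀ x, op x x = x

/-- `(A; ∘)` is a Boolean group: a group in which the square of every element is the neutral
element. -/
def IsBooleanGroup {A : Type*} (op : A → A → A) : Prop :=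
  ∃ G : Group A, (∀ x y : A, op x y = G.mul x y) ∧ ∀ x : A, op x x = G.one

end ArgRec

namespace ArgRec

open Finset

/-! Semilattices and Boolean groups are treated together. Inside a suitable commutative monoid, term
operations become monomials, and every exponent matters only through the corresponding power of one
element `α`, which is either `1` or `α`. Call a place essential if this power is not `1`. The rank
counts essential places; it decreases weakly under minors and, in fixed arity, determines a monomial
up to equivalence.

Two facts then suffice. Recognition (`exists_hasExponents_of_identMinor`): if all identification
minors are monomials, so is the function, since its arity exceeds the size of `A` and each tuple
therefore has a repeated entry. Rank recovery (`rank_le_of_setDeck_eq`, applied in both directions):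
identifying two essential places lowers the rank by a constant `d`, any other identification
preserves it, and so the set of ranks of the cards gives back the rank. -/

/-- A presentation of `A` inside a commutative monoid `M`, with a character `χ` and two elements
`e`, `a` of `A` such that `χ e = 1` and the powers of `χ a` detect the exponents of all elements
of `A`. -/
structure Linearization (A M N : Type*) [CommMonoid M] [CommMonoid N] where
  /-- the embedding of `A` -/
  emb : A → M
  emb_injective : Function.Injective emb
  /-- the character -/
  χ : M →* N
  /-- an element in the kernel of the character -/
  e : A
  /-- an element outside the kernel of the character -/
  a : A
  χ_e : χ (emb e) = 1
  χ_a_ne_one : χ (emb a) ≠ 1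
  χ_a_sq : χ (emb a) * χ (emb a) = χ (emb a) ∨ χ (emb a) * χ (emb a) = 1
  pow_eq_pow : ∀ u v : ℕ, χ (emb a) ^ u = χ (emb a) ^ v → ∀ x, emb x ^ u = emb x ^ v

/-! ### Monomials and their rank -/

namespace Linearization

variable {A M N : Type*} [CommMonoid M] [CommMonoid N] (L : Linearization A M N)

/-- The value of the character at `a`. -/
def α : N := L.χ (L.emb L.a)

theorem α_pow (u : ℕ) : L.α ^ u = 1 ∨ L.α ^ u = L.α := by
  induction u with
  | zero => exact Or.inl (pow_zero _)
  | succ u ih =>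
    rw [pow_succ]
    rcases ih with h | h
    · rw [h, one_mul]; exact Or.inr rfl
    · rw [h]; exact L.χ_a_sq.symm

/-- `f` is the monomial with exponent vector `w`. -/
def HasExponents {n : ℕ} (f : Fn A A n) (w : Fin n → ℕ) : Prop :=
  ∀ c, L.emb (f c) = ∏ l, L.emb (c l) ^ w l

/-- The tuple with `a` at the places in `s` and `e` elsewhere. -/
def pt {n : ℕ} (s : Finset (Fin n)) : Fin n → A := fun l => if l ∈ s then L.a else L.e

open Classical in
/-- The number of places at which the monomial `f` has a nontrivial exponent. -/
noncomputable def rank {n : ℕ} (f : Fn A A n) : ℕ := #{l | L.χ (L.emb (f (L.pt {l}))) ≠ 1}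

variable {L}

theorem χ_pt {n : ℕ} (w : Fin n → ℕ) (s : Finset (Fin n)) :
    L.χ (∏ l, L.emb (L.pt s l) ^ w l) = ∏ l ∈ s, L.α ^ w l := by
  rw [map_prod, ← Finset.prod_subset (Finset.subset_univ s)]
  · exact Finset.prod_congr rfl fun l hl => by simp [pt, hl, α]
  · intro l _ hl
    simp [pt, hl, L.χ_e]

theorem HasExponents.χ_pt_singleton {n : ℕ} {f : Fn A A n} {w : Fin n → ℕ}
    (h : L.HasExponents f w) (l : Fin n) : L.χ (L.emb (f (L.pt {l}))) = L.α ^ w l := by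
  rw [h, χ_pt, Finset.prod_singleton]

open Classical in
theorem HasExponents.rank_eq {n : ℕ} {f : Fn A A n} {w : Fin n → ℕ}
    (h : L.HasExponents f w) : L.rank f = #{l | L.α ^ w l ≠ 1} := by
  simp only [rank, h.χ_pt_singleton]

theorem HasExponents.comp {n m : ℕ} {f : Fn A A m} {v : Fin m → ℕ} (h : L.HasExponents f v)
    (σ : Fin m → Fin n) :
    L.HasExponents (fun c => f (c ∘ σ)) (fun l => ∑ m with σ m = l, v m) := by
  intro c
  rw [h, ← Finset.prod_fiberwise Finset.univ σ]
  refine Finset.prod_congr rfl fun l _ => ?_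
  rw [← Finset.prod_pow_eq_pow_sum]
  refine Finset.prod_congr rfl fun m hm => ?_
  rw [Function.comp_apply, (Finset.mem_filter.1 hm).2]

theorem HasExponents.of_isMinor {n m : ℕ} {g : Fn A A n} {f : Fn A A m} {v : Fin m → ℕ}
    (h : L.HasExponents f v) (hg : IsMinor g f) : ∃ w, L.HasExponents g w := by
  obtain ⟨σ, hσ⟩ := hg
  obtain rfl : g = fun c => f (c ∘ σ) := funext hσ
  exact ⟨_, h.comp σ⟩

/-- A product of powers of `α` differs from `1` only if some factor does, so the essential places of
a minor lie in the image of those of the original function. -/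
theorem HasExponents.rank_le {n m : ℕ} {g : Fn A A n} {f : Fn A A m} {v : Fin m → ℕ}
    (h : L.HasExponents f v) (hg : IsMinor g f) : L.rank g ≤ L.rank f := by
  classical
  obtain ⟨σ, hσ⟩ := hg
  obtain rfl : g = fun c => f (c ∘ σ) := funext hσ
  rw [h.rank_eq, (h.comp σ).rank_eq]
  refine (Finset.card_le_card fun l hl => ?_).trans (Finset.card_image_le (f := σ))
  rw [Finset.mem_filter, ← Finset.prod_pow_eq_pow_sum] at hl
  obtain ⟨m, hm, hm'⟩ := Finset.exists_ne_one_of_prod_ne_one hl.2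
  exact Finset.mem_image.2 ⟨m, by simpa using hm', (Finset.mem_filter.1 hm).2⟩

/-- A permutation carrying essential places to essential places matches the powers of `α`, hence all
exponents as far as they act on `A`. -/
theorem HasExponents.isMinor_of_rank_eq {n : ℕ} {f g : Fn A A n} {v w : Fin n → ℕ}
    (hf : L.HasExponents f v) (hg : L.HasExponents g w) (h : L.rank f = L.rank g) :
    IsMinor g f := by
  classical
  rw [hf.rank_eq, hg.rank_eq] at h
  have hc : Fintype.card {l // L.α ^ v l ≠ 1} = Fintype.card {l // L.α ^ w l ≠ 1} := by
    rw [Fintype.card_subtype, Fintype.card_subtype, h]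
  let p := (Fintype.equivOfCardEq hc).extendSubtype
  have hp : ∀ l, L.α ^ v l = L.α ^ w (p l) := by
    intro l
    by_cases hl : L.α ^ v l ≠ 1
    · have h1 : L.α ^ w (p l) ≠ 1 := (Fintype.equivOfCardEq hc).extendSubtype_mem l hl
      rw [(L.α_pow _).resolve_left hl, (L.α_pow _).resolve_left h1]
    · have h1 : ¬ L.α ^ w (p l) ≠ 1 := (Fintype.equivOfCardEq hc).extendSubtype_not_mem l hl
      rw [not_not.1 hl, not_not.1 h1]
  refine ⟨p, fun c => L.emb_injective ?_⟩
  rw [hf, hg, ← Equiv.prod_comp p]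
  exact Finset.prod_congr rfl fun l _ => (L.pow_eq_pow _ _ (hp l) _).symm

theorem HasExponents.equivalent_of_rank_eq {n : ℕ} {f g : Fn A A n} {v w : Fin n → ℕ}
    (hf : L.HasExponents f v) (hg : L.HasExponents g w) (h : L.rank f = L.rank g) :
    Equivalent f g :=
  ⟨hg.isMinor_of_rank_eq hf h.symm, hf.isMinor_of_rank_eq hg h⟩

/-- The monomials form a clone. -/
theorem isClone_hasExponents (L : Linearization A M N) :
    IsClone {f : AnyFn A A | ∃ w, L.HasExponents f.2 w} where
  proj_mem n i := ⟨Pi.single i 1, fun c => by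
    rw [Finset.prod_eq_single i]
    · simp
    · intro l _ hl
      simp [hl]
    · simp⟩
  comp_mem n m f g := by
    rintro ⟨v, hv⟩ hg
    choose u hu using hg
    refine ⟨fun l => ∑ i, u i l * v i, fun c => ?_⟩
    refine (hv _).trans ?_
    simp_rw [← Finset.prod_pow_eq_pow_sum]
    rw [Finset.prod_comm]
    refine Finset.prod_congr rfl fun i _ => ?_
    rw [show L.emb (g i c) = _ from hu i c, ← Finset.prod_pow]
    exact Finset.prod_congr rfl fun l _ => (pow_mul _ _ _).symm

theorem exists_hasExponents_of_mem_Clo (L : Linearization A M N) {op : A → A → A}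
    (hop : ∀ x y, L.emb (op x y) = L.emb x * L.emb y) {f : AnyFn A A} (hf : f ∈ Clo op) :
    ∃ w, L.HasExponents f.2 w := by
  refine hf _ L.isClone_hasExponents ⟨fun _ => 1, fun c => ?_⟩
  refine (hop _ _).trans ?_
  simp only [pow_one]
  exact (Fin.prod_univ_two (fun l : Fin 2 => L.emb (c l))).symm

end Linearization

/-! ### Identification minors and tuples with a repeated entry -/

theorem delta_succAbove {n : ℕ} {i j : Fin (n + 1)} (hij : i < j) (m : Fin n) :
    delta i j hij (j.succAbove m) = m := by
  unfold delta
  rcases lt_or_ge m.castSucc j with h | h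
  · rw [Fin.succAbove_of_castSucc_lt _ _ h, dif_pos h]
    rfl
  · rw [Fin.succAbove_of_le_castSucc _ _ h]
    have h1 : j < m.succ := lt_of_le_of_lt h Fin.castSucc_lt_succ
    rw [dif_neg h1.not_gt, dif_neg h1.ne']
    rfl

theorem succAbove_delta_self {n : ℕ} {i j : Fin (n + 1)} (hij : i < j) :
    j.succAbove (delta i j hij j) = i := by
  have h : delta i j hij j = ⟨i, by omega⟩ := by simp [delta]
  rw [h, Fin.succAbove_of_castSucc_lt]
  · rfl
  · exact hij

/-- Deleting coordinate `j` loses nothing when it repeats coordinate `i`; thus the identification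
minor determines the function on all such tuples. -/
theorem comp_succAbove_comp_delta {A : Type*} {n : ℕ} {i j : Fin (n + 1)} (hij : i < j)
    {c : Fin (n + 1) → A} (hc : c i = c j) : (c ∘ j.succAbove) ∘ delta i j hij = c := by
  funext l
  rcases eq_or_ne l j with rfl | hl
  · simp [succAbove_delta_self, hc]
  · obtain ⟨m, rfl⟩ := Fin.exists_succAbove_eq hl
    simp [delta_succAbove]

/-! ### The rank is determined by the set-deck -/

namespace Linearization

variable {A M N : Type*} [CommMonoid M] [CommMonoid N] {L : Linearization A M N}

theorem HasExponents.identMinor {n : ℕ} {f : Fn A A (n + 1)} {w : Fin (n + 1) → ℕ}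
    (h : L.HasExponents f w) {i j : Fin (n + 1)} (hij : i < j) :
    L.HasExponents (n := n) (identMinor f i j hij)
      (fun m => w (j.succAbove m) + if m = delta i j hij j then w j else 0) := by
  intro b
  refine (h _).trans ?_
  rw [Fin.prod_univ_succAbove _ j]
  simp only [pow_add, Finset.prod_mul_distrib, Function.comp_apply, delta_succAbove]
  rw [mul_comm]
  congr 1
  simp [pow_ite]

open Classical in
theorem HasExponents.rank_identMinor {n : ℕ} {f : Fn A A (n + 1)} {w : Fin (n + 1) → ℕ}
    (h : L.HasExponents f w) {i j : Fin (n + 1)} (hij : i < j) :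
    ∃ R, L.rank f = (if L.α ^ w i ≠ 1 then 1 else 0) + (if L.α ^ w j ≠ 1 then 1 else 0) + R ∧
      L.rank (n := n) (ArgRec.identMinor f i j hij) =
        (if L.α ^ (w i + w j) ≠ 1 then 1 else 0) + R := by
  obtain ⟨p, hp⟩ : ∃ p : Fin n, p = delta i j hij j := ⟨_, rfl⟩
  have hpi : j.succAbove p = i := hp ▸ succAbove_delta_self hij
  rw [h.rank_eq, (h.identMinor hij).rank_eq, Finset.card_filter, Finset.card_filter,
    Fin.sum_univ_succAbove _ j, ← hp, ← Finset.add_sum_erase _ _ (Finset.mem_univ p), hpi]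
  refine ⟨_, by rw [← add_assoc, add_comm (ite (L.α ^ w j ≠ 1) _ _)], ?_⟩
  rw [← Finset.add_sum_erase _ _ (Finset.mem_univ p), hpi, if_pos rfl]
  congr 1
  refine Finset.sum_congr rfl fun m hm => ?_
  rw [if_neg (Finset.ne_of_mem_erase hm), add_zero]

/-- The drop of the rank when two places with nontrivial exponents are identified. -/
theorem exists_rank_drop (L : Linearization A M N) : ∃ d : ℕ, 1 ≤ d ∧ d ≤ 2 ∧
    ∀ {n : ℕ} {f : Fn A A (n + 1)} {w : Fin (n + 1) → ℕ}, L.HasExponents f w →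
    ∀ {i j : Fin (n + 1)} (hij : i < j),
      (L.α ^ w i ≠ 1 → L.α ^ w j ≠ 1 → L.rank (n := n) (identMinor f i j hij) + d = L.rank f) ∧
      (L.α ^ w i = 1 ∨ L.α ^ w j = 1 → L.rank (n := n) (identMinor f i j hij) = L.rank f) := by
  classical
  have hα : L.α ≠ 1 := L.χ_a_ne_one
  -- The merged place has power `α * α`: it stays essential when this is `α` (drop 1) and vanishes
  -- when it is `1` (drop 2).
  have key : ∃ d : ℕ, 1 ≤ d ∧ d ≤ 2 ∧ (if L.α * L.α ≠ 1 then 1 else 0) + d = 2 := by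
    by_cases h : L.α * L.α ≠ 1
    · exact ⟨1, by simp [h]⟩
    · exact ⟨2, by simp [h]⟩
  obtain ⟨d, hd1, hd2, hd⟩ := key
  refine ⟨d, hd1, hd2, fun {n f w} h i j hij => ?_⟩
  obtain ⟨R, h1, h2⟩ := h.rank_identMinor hij
  rw [h1, h2, pow_add]
  constructor
  · intro hi hj
    rw [(L.α_pow _).resolve_left hi, (L.α_pow _).resolve_left hj, if_pos hα]
    omega
  · rintro (hi | hj)
    · simp [hi]
    · simp [hj]

theorem rank_le_of_setDeck_eq {n : ℕ} (hn : 3 ≤ n) {f g : Fn A A (n + 1)}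
    {v w : Fin (n + 1) → ℕ} (hf : L.HasExponents f v) (hg : L.HasExponents g w)
    (h : setDeck f = setDeck g) : L.rank g ≤ L.rank f := by
  classical
  obtain ⟨d, hd1, hd2, hd⟩ := L.exists_rank_drop
  have transfer : ∀ {f g : Fn A A (n + 1)} {v w : Fin (n + 1) → ℕ}, L.HasExponents f v →
      L.HasExponents g w → setDeck f = setDeck g → ∀ i j (hij : i < j), ∃ i' j',
      ∃ hij' : i' < j', L.rank (n := n) (identMinor f i j hij) =
        L.rank (n := n) (identMinor g i' j' hij') := by
    intro f g v w hf hg h i j hij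
    have hmem : card f i j hij ∈ setDeck g := h ▸ ⟨i, j, hij, rfl⟩
    obtain ⟨i', j', hij', hc⟩ := hmem
    have he : Equivalent (n := n) (m := n) (identMinor f i j hij) (identMinor g i' j' hij') :=
      Quotient.exact hc
    exact ⟨i', j', hij', le_antisymm ((hg.identMinor hij').rank_le he.1)
      ((hf.identMinor hij).rank_le he.2)⟩
  have ordered : ∀ (P : Fin (n + 1) → Fin (n + 1) → Prop), (∀ i j, P i j → P j i) →
      (∃ i j, i ≠ j ∧ P i j) → ∃ i j, i < j ∧ P i j := by
    rintro P hP ⟨i, j, hij, hp⟩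
    rcases lt_or_gt_of_ne hij with h | h
    exacts [⟨i, j, h, hp⟩, ⟨j, i, h, hP _ _ hp⟩]
  have unchanged : ∀ {f : Fn A A (n + 1)} {v : Fin (n + 1) → ℕ}, L.HasExponents f v →
      L.rank f < n + 1 → ∃ i j, ∃ hij : i < j,
        L.rank (n := n) (identMinor f i j hij) = L.rank f := by
    intro f v hf hr
    have : ∃ l, L.α ^ v l = 1 := by
      by_contra! hcon
      rw [hf.rank_eq, Finset.filter_true_of_mem fun l _ => hcon l] at hr
      simp at hr
    obtain ⟨l, hl⟩ := this
    have : Nontrivial (Fin (n + 1)) := Fin.nontrivial_iff_two_le.2 (by omega)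
    obtain ⟨m, hm⟩ := exists_ne l
    obtain ⟨i, j, hij, hp⟩ := ordered (fun i j => L.α ^ v i = 1 ∨ L.α ^ v j = 1)
      (fun i j hp => hp.symm) ⟨m, l, hm, Or.inr hl⟩
    exact ⟨i, j, hij, (hd hf hij).2 hp⟩
  by_contra! hlt
  have hgn : L.rank g ≤ n + 1 := (Finset.card_le_univ _).trans_eq (Fintype.card_fin _)
  rcases hgn.lt_or_eq with hgn | hgn
  -- Some card of `g` keeps the rank of `g`; being also a card of `f`, its rank is at most that of
  -- `f`, a contradiction.
  · obtain ⟨i, j, hij, hr⟩ := unchanged hg hgn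
    obtain ⟨i', j', hij', hr'⟩ := transfer hg hf h.symm i j hij
    have := hf.rank_le (g := identMinor f i' j' hij') ⟨_, fun _ => rfl⟩
    change L.rank (n := n) (identMinor f i' j' hij') ≤ _ at this
    omega
  · have full : ∀ l, L.α ^ w l ≠ 1 := by
      rw [hg.rank_eq] at hgn
      have := (Finset.card_eq_iff_eq_univ _).1 (hgn.trans (Fintype.card_fin _).symm)
      intro l
      have hl := Finset.mem_univ l
      rw [← this] at hl
      exact (Finset.mem_filter.1 hl).2
    obtain ⟨i, j, hij, hr⟩ := unchanged hf (by omega)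
    obtain ⟨i', j', hij', hr'⟩ := transfer hf hg h i j hij
    have h1 := (hd hg hij').1 (full _) (full _)
    -- All cards of `g` have rank `n + 1 - d`, and `f` has a card of its own rank, so `f` has rank
    -- `n + 1 - d ≥ 2`. Identifying two essential places of `f` then gives a card of rank `n + 1 - 2
    -- * d`, which `g` does not have.
    have h2 : 1 < L.rank f := by omega
    rw [hf.rank_eq] at h2
    obtain ⟨p, hp, q, hq, hpq⟩ := Finset.one_lt_card.1 h2
    obtain ⟨i₂, j₂, hij₂, hi₂, hj₂⟩ := ordered (fun i j => L.α ^ v i ≠ 1 ∧ L.α ^ v j ≠ 1)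
      (fun i j hp => hp.symm)
      ⟨p, q, hpq, (Finset.mem_filter.1 hp).2, (Finset.mem_filter.1 hq).2⟩
    obtain ⟨i₃, j₃, hij₃, hr₃⟩ := transfer hf hg h i₂ j₂ hij₂
    have h3 := (hd hg hij₃).1 (full _) (full _)
    have h4 := (hd hf hij₂).1 hi₂ hj₂
    omega

/-! ### Recognition of monomials from their identification minors -/

/-- A function of sufficiently large arity all of whose identification minors are monomials is a
monomial. -/
theorem exists_hasExponents_of_identMinor [Finite A] {n : ℕ} (hn : 3 ≤ n)
    (hA : Nat.card A ≤ n) {f : Fn A A (n + 1)}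
    (h : ∀ i j (hij : i < j), ∃ w, L.HasExponents (n := n) (identMinor f i j hij) w) :
    ∃ w, L.HasExponents f w := by
  classical
  have h1 : ∀ i j : Fin (n + 1), i ≠ j → ∃ u : Fin (n + 1) → ℕ, ∀ c : Fin (n + 1) → A,
      c i = c j → L.emb (f c) = ∏ l, L.emb (c l) ^ u l := by
    have hlt : ∀ i j : Fin (n + 1), i < j → ∃ u : Fin (n + 1) → ℕ, ∀ c : Fin (n + 1) → A,
        c i = c j → L.emb (f c) = ∏ l, L.emb (c l) ^ u l := by
      intro i j hij
      obtain ⟨v, hv⟩ := h i j hij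
      -- The exponents of the minor are moved back along `j.succAbove`, with exponent `0` at `j`.
      refine ⟨fun l => ∑ m with j.succAbove m = l, v m, fun c hc => ?_⟩
      have hc' : L.emb (f ((c ∘ j.succAbove) ∘ delta i j hij)) = _ := hv.comp j.succAbove c
      rwa [comp_succAbove_comp_delta hij hc] at hc'
    intro i j hij
    rcases lt_or_gt_of_ne hij with h | h
    · exact hlt i j h
    · obtain ⟨u, hu⟩ := hlt j i h
      exact ⟨u, fun c hc => hu c hc.symm⟩
  choose! u hu using h1
  -- At least four places are available, so two remain outside any set of at most two.
  have avoid : ∀ s : Finset (Fin (n + 1)), #s ≤ 2 → ∃ i j, i ≠ j ∧ i ∉ s ∧ j ∉ s := by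
    intro s hs
    have hc : 1 < #sᶜ := by
      rw [Finset.card_compl, Fintype.card_fin]
      omega
    obtain ⟨i, hi, j, hj, hij⟩ := Finset.one_lt_card.1 hc
    exact ⟨i, j, hij, Finset.mem_compl.1 hi, Finset.mem_compl.1 hj⟩
  have eval : ∀ (s : Finset (Fin (n + 1))) (i j), i ≠ j → (i ∈ s ↔ j ∈ s) →
      L.χ (L.emb (f (L.pt s))) = ∏ l ∈ s, L.α ^ u i j l := by
    intro s i j hij hs
    rw [hu i j hij _ (by simp [pt, hs]), χ_pt]
  -- The value of `f` at `pt {l}` fixes the power of `α` at `l`, whichever pair avoiding `l` is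
  -- used.
  have single : ∀ l, ∃ t : ℕ, ∀ i j, i ≠ j → l ≠ i → l ≠ j → L.α ^ u i j l = L.α ^ t := by
    intro l
    obtain ⟨i, j, hij, hi, hj⟩ := avoid {l} (by simp)
    refine ⟨u i j l, fun i' j' hij' hi' hj' => ?_⟩
    have e1 := eval {l} i j hij (by simp [hi, hj])
    have e2 := eval {l} i' j' hij' (by simp [hi'.symm, hj'.symm])
    rw [Finset.prod_singleton] at e1 e2
    rw [← e1, ← e2]
  choose w hw using single
  -- On tuples with equal entries at `i` and `j` only the sum of those two exponents matters. It is
  -- found by evaluating at `pt {i, j}`, which also has equal entries at a disjoint pair.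
  have pair : ∀ i j, i ≠ j → L.α ^ (u i j i + u i j j) = L.α ^ (w i + w j) := by
    intro i j hij
    obtain ⟨i', j', hij', hi', hj'⟩ := avoid {i, j} Finset.card_le_two
    have e1 := eval {i, j} i j hij (by simp)
    have e2 := eval {i, j} i' j' hij' (by simp only [hi', hj'])
    rw [Finset.prod_pair hij] at e1 e2
    simp only [Finset.mem_insert, Finset.mem_singleton, not_or] at hi' hj'
    rw [hw i i' j' hij' (Ne.symm hi'.1) (Ne.symm hj'.1),
      hw j i' j' hij' (Ne.symm hi'.2) (Ne.symm hj'.2)] at e2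
    rw [pow_add, pow_add, ← e1, ← e2]
  refine ⟨w, fun c => ?_⟩
  have hninj : ¬ Function.Injective c := fun hinj => by
    have := Nat.card_le_card_of_injective c hinj
    rw [Nat.card_eq_fintype_card, Fintype.card_fin] at this
    omega
  obtain ⟨i, j, hc, hij⟩ : ∃ i j, c i = c j ∧ i ≠ j := by
    simpa [Function.Injective] using hninj
  rw [hu i j hij c hc, ← Finset.prod_mul_prod_compl {i, j},
    ← Finset.prod_mul_prod_compl {i, j} (fun l => L.emb (c l) ^ w l),
    Finset.prod_pair hij, Finset.prod_pair hij, ← hc, ← pow_add, ← pow_add,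
    L.pow_eq_pow _ _ (pair i j hij)]
  congr 1
  refine Finset.prod_congr rfl fun l hl => L.pow_eq_pow _ _ (hw l i j hij ?_ ?_) _
  · rintro rfl; simp at hl
  · rintro rfl; simp at hl

theorem HasExponents.setReconstructible [Finite A] {n : ℕ} (hn : 3 ≤ n)
    (hA : Nat.card A ≤ n) {f : Fn A A (n + 1)} {w : Fin (n + 1) → ℕ}
    (hf : L.HasExponents f w) : SetReconstructible f := by
  intro g hg
  have hg' : ∃ w, L.HasExponents g w := by
    refine exists_hasExponents_of_identMinor hn hA fun i j hij => ?_
    have hmem : card g i j hij ∈ setDeck f := by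
      rw [show setDeck f = setDeck g from hg]
      exact ⟨i, j, hij, rfl⟩
    obtain ⟨i', j', hij', hc⟩ := hmem
    have he : Equivalent (n := n) (m := n) (ArgRec.identMinor g i j hij)
      (ArgRec.identMinor f i' j' hij') := Quotient.exact hc
    exact (hf.identMinor hij').of_isMinor he.1
  obtain ⟨v, hv⟩ := hg'
  exact hf.equivalent_of_rank_eq hv
    (le_antisymm (rank_le_of_setDeck_eq hn hv hf hg.symm) (rank_le_of_setDeck_eq hn hf hv hg))

theorem setReconstructible_of_mem_Clo [Finite A] [Nontrivial A] (L : Linearization A M N)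
    {op : A → A → A} (hop : ∀ x y, L.emb (op x y) = L.emb x * L.emb y) {f : AnyFn A A}
    (hf : f ∈ Clo op) (hn : Nat.card A + 2 ≤ f.1) : SetReconstructible f.2 := by
  obtain ⟨w, hw⟩ := L.exists_hasExponents_of_mem_Clo hop hf
  obtain ⟨⟨n, hpos⟩, f⟩ := f
  obtain ⟨n, rfl⟩ := Nat.exists_eq_succ_of_ne_zero hpos.ne'
  have hA : 1 < Nat.card A := Finite.one_lt_card
  change Nat.card A + 2 ≤ n + 1 at hn
  exact HasExponents.setReconstructible (L := L) (by omega) (by omega) hw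

end Linearization

/-! ### Linearizations of semilattices and Boolean groups -/

open Classical in
theorem IsSemilattice.exists_linearization {A : Type*} [Nontrivial A] {op : A → A → A}
    (h : IsSemilattice op) : ∃ L : Linearization A (A → ℕ) ℕ,
      ∀ x y, L.emb (op x y) = L.emb x * L.emb y := by
  have habs : ∃ e a : A, a ≠ e ∧ op e a = a := by
    obtain ⟨x, y, hxy⟩ := exists_pair_ne A
    by_cases hx : op x y = x
    · exact ⟨y, x, hxy, by rw [h.comm, hx]⟩
    · exact ⟨x, op x y, hx, by rw [← h.assoc, h.idem]⟩
  obtain ⟨e, a, hne, hea⟩ := habs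
  -- With `op` as meet, `x` is sent to the indicator of its down-set, so meets become pointwise
  -- products. Evaluation at `e` is the character, and it vanishes at `a` because `a` lies strictly
  -- below `e`.
  let ι : A → A → ℕ := fun x s => if op s x = s then 1 else 0
  have hα : ι a e = 0 := if_neg (by rw [hea]; exact hne)
  have hidem : ∀ x, ι x * ι x = ι x := fun x => by
    funext s
    simp [ι]
  have hpow : ∀ x (u : ℕ), ι x ^ (u + 1) = ι x := fun x u => by
    induction u with
    | zero => simp
    | succ u ih => rw [pow_succ, ih, hidem]
  refine ⟨{
    emb := ι
    emb_injective := ?_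
    χ := Pi.evalMonoidHom _ e
    e := e
    a := a
    χ_e := if_pos (h.idem e)
    χ_a_ne_one := by simp [hα]
    χ_a_sq := by simp [hα]
    pow_eq_pow := ?_ }, ?_⟩
  · intro x y hxy
    have h1 : op x y = x := by
      have := congrFun hxy x
      simpa [ι, h.idem] using this
    have h2 : op y x = y := by
      have := congrFun hxy y
      simpa [ι, h.idem] using this
    rw [← h1, h.comm, h2]
  · intro u v huv x
    rcases u with _ | u <;> rcases v with _ | v
    · rfl
    · simp [hα] at huv
    · simp [hα] at huv
    · rw [hpow, hpow]
  · intro x y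
    funext s
    have hiff : op s (op x y) = s ↔ op s x = s ∧ op s y = s := by
      constructor
      · intro hs
        constructor
        · calc op s x = op (op s (op x y)) x := by rw [hs]
            _ = op s (op (op x x) y) := by rw [h.assoc, h.comm (op x y) x, ← h.assoc x x y]
            _ = s := by rw [h.idem, hs]
        · calc op s y = op (op s (op x y)) y := by rw [hs]
            _ = op s (op x (op y y)) := by rw [h.assoc, h.assoc x y y]
            _ = s := by rw [h.idem, hs]
      · rintro ⟨hx, hy⟩
        rw [← h.assoc, hx, hy]
    by_cases hx : op s x = s <;> by_cases hy : op s y = s <;> simp [ι, hiff, hx, hy]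

theorem IsBooleanGroup.exists_linearization {A : Type*} [Nontrivial A] {op : A → A → A}
    (h : IsBooleanGroup op) : ∃ (_ : CommMonoid A) (L : Linearization A A A),
      ∀ x y, L.emb (op x y) = L.emb x * L.emb y := by
  obtain ⟨G, hmul, hsq⟩ := h
  have hsq' : ∀ x : A, x * x = 1 := fun x => (hmul x x).symm.trans (hsq x)
  have hcomm : ∀ x y : A, x * y = y * x := fun x y => by
    have hinv : ∀ z : A, z⁻¹ = z := fun z => inv_eq_of_mul_eq_one_left (hsq' z)
    rw [← hinv (x * y), mul_inv_rev, hinv, hinv]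
  obtain ⟨a, ha⟩ := exists_ne (1 : A)
  have hpow : ∀ (x : A) (u : ℕ), x ^ u = if Even u then 1 else x := fun x u => by
    split_ifs with hu
    · obtain ⟨t, rfl⟩ := hu
      rw [← two_mul, pow_mul, sq, hsq', one_pow]
    · obtain ⟨t, rfl⟩ := Nat.not_even_iff_odd.1 hu
      rw [pow_succ, pow_mul, sq, hsq', one_pow, one_mul]
  let _ : CommMonoid A := { G.toMonoid with mul_comm := hcomm }
  -- The group represents itself; any `a ≠ 1` has order 2 and so detects the parity of exponents,
  -- which is all that acts on `A`.
  refine ⟨inferInstance, {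
    emb := id
    emb_injective := Function.injective_id
    χ := MonoidHom.id A
    e := 1
    a := a
    χ_e := rfl
    χ_a_ne_one := ha
    χ_a_sq := Or.inr (hsq' a)
    pow_eq_pow := ?_ }, hmul⟩
  intro u v huv x
  replace huv : (if Even u then 1 else a) = if Even v then 1 else a :=
    (hpow a u).symm.trans (huv.trans (hpow a v))
  refine (hpow x u).trans (Eq.trans ?_ (hpow x v).symm)
  by_cases hu : Even u <;> by_cases hv : Even v <;> simp_all [-Nat.not_even_iff_odd]

end ArgRec

theorem mainTheorem2 {A : Type*} [Finite A] (k : ℕ) (hk : Nat.card A = k)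
    (op : A → A → A) (hop : ArgRec.IsSemilattice op ∨ ArgRec.IsBooleanGroup op)
    (C : Set (ArgRec.AnyFn A A)) (hC : ArgRec.IsClone C) (hCop : C ⊆ ArgRec.Clo op) :
    ArgRec.ClassSetReconstructible (ArgRec.arityAtLeast C (k + 2)) := by
  rintro f ⟨hf, hn⟩
  subst hk
  rcases subsingleton_or_nontrivial A with hA | hA
  · intro g _
    exact ⟨⟨id, fun _ => Subsingleton.elim _ _⟩, ⟨id, fun _ => Subsingleton.elim _ _⟩⟩
  · rcases hop with h | h
    · obtain ⟨L, hL⟩ := h.exists_linearization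
      exact L.setReconstructible_of_mem_Clo hL (hCop hf) hn
    · obtain ⟨_, L, hL⟩ := h.exists_linearization
      exact L.setReconstructible_of_mem_Clo hL (hCop hf) hn
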